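/- Let $A,B$ be complex $n\times n$ matrices such that $mI\le A\le MI$ and $mI\le B\le MI$ (in the Loewner order) for some scalars $0<m<M$, and let $0\le v\le 1$. Write $X\nabla_v Y=(1-v)X+vY$ for the weighted arithmetic mean of matrices and $X\,!_v\,Y=\big((1-v)X^{-1}+vY^{-1}\big)^{-1}$ for the weighted harmonic mean of positive definite matrices. Let $\sigma_v$ be an operator mean in the sense of Kubo and Ando, i.e. a binary operation on positive semidefinite $n\times n$ matrices that is monotone in both variables, satisfies the transformer inequality $C(X\sigma_v Y)C\le (CXC)\,\sigma_v\,(CYC)$ for $C\ge 0$, is continuous along decreasing sequences ($X_k\downarrow X$ and $Y_k\downarrow Y$ imply $X_k\sigma_v Y_k\to X\sigma_v Y$), and satisfies $I\sigma_v I=I$. Assume that $\sigma_v$ lies between the harmonic and the arithmetic mean: $X\,!_v\,Y\le X\sigma_v Y\le X\nabla_v Y$ for all positive definite $X,Y$. Then, for every unitarily invariant norm $\|\cdot\|$ on the complex $n\times n$ matrices, $$\lim_{p\to 0^+}\left\|\left(e^{pA}\,\sigma_v\,e^{pB}\right)^{1/p}\right\|=\left\|e^{A\nabla_v B}\right\|.$$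 -/

import Mathlib

open Filter Topology
open scoped MatrixOrder ComplexOrder

/-- An operator mean in the sense of Kubo and Ando, on the cone of positive semidefinite complex
`n × n` matrices with the Loewner order: a binary operation on the cone that is monotone in both
variables, satisfies the transformer inequality, is continuous along decreasing sequences
(jointly), and is normalized.  Only the values `σ A B` with `0 ≤ A` and `0 ≤ B` are meaningful. -/
structure OperatorMean (n : ℕ) where
  /-- the binary operation -/
  toFun : Matrix (Fin n) (Fin n) ℂ → Matrix (Fin n) (Fin n) ℂ → Matrix (Fin n) (Fin n) ℂ
  nonneg' : ∀ A B, 0 ≤ A → 0 ≤ B → 0 ≤ toFun A B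
  mono' : ∀ A B C D, 0 ≤ A → 0 ≤ B → A ≤ C → B ≤ D → toFun A B ≤ toFun C D
  transformer' : ∀ A B C, 0 ≤ A → 0 ≤ B → 0 ≤ C →
    C * toFun A B * C ≤ toFun (C * A * C) (C * B * C)
  tendsto' : ∀ (a b : ℕ → Matrix (Fin n) (Fin n) ℂ) (A B : Matrix (Fin n) (Fin n) ℂ),
    (∀ k, 0 ≤ a k) → (∀ k, 0 ≤ b k) → Antitone a → Antitone b →
    Tendsto a atTop (𝓝 A) → Tendsto b atTop (𝓝 B) →
    Tendsto (fun k => toFun (a k) (b k)) atTop (𝓝 (toFun A B))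
  one' : toFun 1 1 = 1

instance (n : ℕ) : CoeFun (OperatorMean n) (fun _ =>
    Matrix (Fin n) (Fin n) ℂ → Matrix (Fin n) (Fin n) ℂ → Matrix (Fin n) (Fin n) ℂ) :=
  ⟨OperatorMean.toFun⟩

/-- The weighted arithmetic mean `A ∇_v B = (1 - v) A + v B`. -/
noncomputable def arithMean {n : ℕ} (v : ℝ) (A B : Matrix (Fin n) (Fin n) ℂ) :
    Matrix (Fin n) (Fin n) ℂ :=
  (1 - v) • A + v • B

/-- The weighted harmonic mean `A !_v B = ((1 - v) A⁻¹ + v B⁻¹)⁻¹` of positive definite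
matrices. -/
noncomputable def harmMean {n : ℕ} (v : ℝ) (A B : Matrix (Fin n) (Fin n) ℂ) :
    Matrix (Fin n) (Fin n) ℂ :=
  (arithMean v A⁻¹ B⁻¹)⁻¹

/-- The operator mean `σ` lies between the `v`-weighted harmonic and arithmetic means:
`A !_v B ≤ A σ B ≤ A ∇_v B` for all positive definite `A`, `B`. -/
def OperatorMean.IsBetween {n : ℕ} (σ : OperatorMean n) (v : ℝ) : Prop :=
  ∀ A B : Matrix (Fin n) (Fin n) ℂ, A.PosDef → B.PosDef →
    harmMean v A B ≤ σ A B ∧ σ A B ≤ arithMean v A B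

/-- A unitarily invariant norm on the complex `n × n` matrices. -/
structure UnitarilyInvariantNorm (n : ℕ) extends Seminorm ℂ (Matrix (Fin n) (Fin n) ℂ) where
  eq_zero_of_map_eq_zero' : ∀ X, toFun X = 0 → X = 0
  map_unitary_mul_mul' : ∀ U ∈ Matrix.unitaryGroup (Fin n) ℂ,
    ∀ V ∈ Matrix.unitaryGroup (Fin n) ℂ, ∀ X, toFun (U * X * V) = toFun X

instance (n : ℕ) : CoeFun (UnitarilyInvariantNorm n) (fun _ => Matrix (Fin n) (Fin n) ℂ → ℝ) :=
  ⟨fun N => N.toFun⟩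

/-!
The functions `p ↦ e^{pA} ∇_v e^{pB}` and `p ↦ e^{pA} !_v e^{pB} = (e^{-pA} ∇_v e^{-pB})⁻¹` both
take the value `1` at `p = 0`, and both have derivative `C = A ∇_v B` there.  Since
`e^{pA} σ e^{pB}` lies between them in the Loewner order, its difference quotients
`p⁻¹ (e^{pA} σ e^{pB} - 1)` are squeezed to `C` as `p → 0⁺`
(`CStarAlgebra.tendsto_of_tendsto_of_tendsto_of_le_of_le`).

For a path `S` of nonnegative elements with `p⁻¹ (S p - 1) → C`, the bound
`‖log a - (a - 1)‖ ≤ 2 ‖a - 1‖ ^ 2` near `1` gives `p⁻¹ log (S p) → C`; hence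
`S p ^ (1 / p) = exp (p⁻¹ log (S p)) → exp C` (`CFC.tendsto_rpow_one_div`).  So the matrices
themselves converge, and a seminorm on a finite-dimensional space is continuous.
-/

/-! ### The logarithm near the identity -/

lemma Real.abs_log_sub_sub_one_le {t δ : ℝ} (h : |t - 1| ≤ δ) (hδ : δ ≤ 1 / 2) :
    |Real.log t - (t - 1)| ≤ 2 * δ ^ 2 := by
  have ht : 1 / 2 ≤ t := by linarith [neg_le_of_abs_le h]
  have hpos : 0 < t := by linarith
  have h1 := Real.log_le_sub_one_of_pos hpos
  have h2 := Real.one_sub_inv_le_log_of_pos hpos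
  have h3 : t⁻¹ ≤ 2 := by
    rw [inv_le_comm₀ hpos two_pos]
    linarith
  have h4 : t - 1 - (1 - t⁻¹) = (t - 1) ^ 2 * t⁻¹ := by
    field_simp
  have h5 : (t - 1) ^ 2 ≤ δ ^ 2 := by
    rw [← sq_abs]
    gcongr
  have h6 : (t - 1) ^ 2 * t⁻¹ ≤ δ ^ 2 * 2 := by gcongr
  rw [abs_sub_comm, abs_of_nonneg (by linarith)]
  linarith

namespace CFC

variable {𝓐 : Type*} [NormedRing 𝓐] [StarRing 𝓐] [NormedAlgebra ℝ 𝓐]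
  [IsometricContinuousFunctionalCalculus ℝ 𝓐 IsSelfAdjoint]

lemma abs_sub_one_le_norm_sub_one {a : 𝓐} (ha : IsSelfAdjoint a) {t : ℝ}
    (ht : t ∈ spectrum ℝ a) : |t - 1| ≤ ‖a - 1‖ := by
  have h : cfc (fun x : ℝ => x - 1) a = a - 1 := by
    rw [cfc_sub (fun x : ℝ => x) (fun _ => 1) a, cfc_id' ℝ a, cfc_const_one ℝ a]
  simpa [h] using norm_apply_le_norm_cfc (fun x : ℝ => x - 1) a ht

lemma pos_of_mem_spectrum_of_norm_sub_one_le {a : 𝓐} (ha : IsSelfAdjoint a)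
    (h : ‖a - 1‖ ≤ 1 / 2) {t : ℝ} (ht : t ∈ spectrum ℝ a) : 0 < t := by
  linarith [neg_le_of_abs_le (abs_sub_one_le_norm_sub_one ha ht)]

lemma norm_log_sub_sub_one_le {a : 𝓐} (ha : IsSelfAdjoint a) (h : ‖a - 1‖ ≤ 1 / 2) :
    ‖log a - (a - 1)‖ ≤ 2 * ‖a - 1‖ ^ 2 := by
  have hlog : ContinuousOn Real.log (spectrum ℝ a) := Real.continuousOn_log.mono fun t ht =>
    (pos_of_mem_spectrum_of_norm_sub_one_le ha h ht).ne'
  have h' : cfc (fun x : ℝ => Real.log x - (x - 1)) a = log a - (a - 1) := by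
    rw [cfc_sub Real.log (fun x : ℝ => x - 1) a, cfc_sub (fun x : ℝ => x) (fun _ => 1) a,
      cfc_id' ℝ a, cfc_const_one ℝ a, log]
  rw [← h']
  exact norm_cfc_le (by positivity) fun t ht =>
    Real.abs_log_sub_sub_one_le (abs_sub_one_le_norm_sub_one ha ht) h

variable [PartialOrder 𝓐] [StarOrderedRing 𝓐] [NonnegSpectrumClass ℝ 𝓐]

lemma rpow_eq_exp_smul_log {a : 𝓐} (ha : 0 ≤ a) (hpos : ∀ t ∈ spectrum ℝ a, 0 < t) (y : ℝ) :
    a ^ y = NormedSpace.exp (y • log a) := by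
  have hlog : ContinuousOn Real.log (spectrum ℝ a) :=
    Real.continuousOn_log.mono fun t ht => (hpos t ht).ne'
  rw [rpow_eq_cfc_real ha, log, ← cfc_const_mul y Real.log a hlog,
    ← real_exp_eq_normedSpace_exp (cfc_predicate _ a),
    ← cfc_comp' Real.exp (fun x => y * Real.log x) a]
  refine cfc_congr fun t ht => ?_
  rw [Real.rpow_def_of_pos (hpos t ht), mul_comm]

/-- If `S p = 1 + p C + o(p)` as `p → 0⁺`, then `S p ^ (1 / p) → exp C`. -/
theorem tendsto_rpow_one_div [CompleteSpace 𝓐] {S : ℝ → 𝓐} {C : 𝓐}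
    (hS : ∀ p, 0 ≤ S p) (hC : Tendsto (fun p => p⁻¹ • (S p - 1)) (𝓝[>] 0) (𝓝 C)) :
    Tendsto (fun p => S p ^ (1 / p)) (𝓝[>] 0) (𝓝 (NormedSpace.exp C)) := by
  have hp0 : Tendsto (fun p : ℝ => p) (𝓝[>] 0) (𝓝 0) := nhdsWithin_le_nhds
  have hpos : ∀ᶠ p : ℝ in 𝓝[>] 0, 0 < p := self_mem_nhdsWithin
  have hS1 : Tendsto (fun p => ‖S p - 1‖) (𝓝[>] 0) (𝓝 0) := by
    have h := (hp0.smul hC).norm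
    rw [zero_smul, norm_zero] at h
    refine h.congr' ?_
    filter_upwards [hpos] with p hp
    rw [smul_inv_smul₀ hp.ne']
  have hsmall : ∀ᶠ p in 𝓝[>] 0, ‖S p - 1‖ ≤ 1 / 2 :=
    hS1.eventually_le_const (by norm_num)
  have herr : Tendsto (fun p => p⁻¹ • (log (S p) - (S p - 1))) (𝓝[>] 0) (𝓝 0) := by
    have hbound : Tendsto (fun p => 2 * ‖p⁻¹ • (S p - 1)‖ * ‖S p - 1‖) (𝓝[>] 0) (𝓝 0) := by
      simpa using (hC.norm.const_mul 2).mul hS1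
    refine squeeze_zero_norm' ?_ hbound
    filter_upwards [hpos, hsmall] with p hp hle
    rw [norm_smul, norm_smul]
    calc ‖p⁻¹‖ * ‖log (S p) - (S p - 1)‖ ≤ ‖p⁻¹‖ * (2 * ‖S p - 1‖ ^ 2) := by
          gcongr
          exact norm_log_sub_sub_one_le (.of_nonneg (hS p)) hle
      _ = 2 * (‖p⁻¹‖ * ‖S p - 1‖) * ‖S p - 1‖ := by ring
  have hlog : Tendsto (fun p => p⁻¹ • log (S p)) (𝓝[>] 0) (𝓝 C) := by
    simpa [← smul_add] using herr.add hC
  let +nondep : NormedAlgebra ℚ 𝓐 := .restrictScalars ℚ ℝ 𝓐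
  refine ((NormedSpace.exp_continuous.tendsto C).comp hlog).congr' ?_
  filter_upwards [hsmall] with p hle
  rw [rpow_eq_exp_smul_log (hS p)
    (fun t ht => pos_of_mem_spectrum_of_norm_sub_one_le (.of_nonneg (hS p)) hle ht), one_div]
  rfl

end CFC

/-! ### Order squeeze and derivative of the inverse -/

/-- Squeeze theorem in a C⋆-algebra.  The order topology is not available here; the norm is
monotone on nonnegative elements instead. -/
lemma CStarAlgebra.tendsto_of_tendsto_of_tendsto_of_le_of_le {𝓐 ι : Type*} [CStarAlgebra 𝓐]
    [PartialOrder 𝓐] [StarOrderedRing 𝓐] {l : Filter ι} {f g h : ι → 𝓐} {C : 𝓐}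
    (hf : Tendsto f l (𝓝 C)) (hh : Tendsto h l (𝓝 C))
    (hfg : ∀ᶠ i in l, f i ≤ g i) (hgh : ∀ᶠ i in l, g i ≤ h i) : Tendsto g l (𝓝 C) := by
  have hsub : Tendsto (fun i => g i - f i) l (𝓝 0) := by
    refine squeeze_zero_norm' ?_ (by simpa using (hh.sub hf).norm)
    filter_upwards [hfg, hgh] with i h1 h2
    exact CStarAlgebra.norm_le_norm_of_nonneg_of_le (sub_nonneg.2 h1) (sub_le_sub_right h2 _)
  simpa using hsub.add hf

lemma HasDerivAt.ringInverse_of_eq_one {𝓐 : Type*} [NormedRing 𝓐] [NormedAlgebra ℝ 𝓐]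
    [CompleteSpace 𝓐] {f : ℝ → 𝓐} {f' : 𝓐} {x : ℝ} (hf : HasDerivAt f f' x) (hx : f x = 1) :
    HasDerivAt (fun t => Ring.inverse (f t)) (-f') x := by
  have h := hasFDerivAt_ringInverse (𝕜 := ℝ) (1 : 𝓐ˣ)
  rw [Units.val_one, ← hx] at h
  simpa using! h.comp_hasDerivAt x hf

/-! ### Exponential paths of matrices -/

section Matrix

open scoped Matrix.Norms.L2Operator

variable {n : ℕ} {A B : Matrix (Fin n) (Fin n) ℂ}

lemma Matrix.IsHermitian.posDef_exp (hA : A.IsHermitian) : (NormedSpace.exp A).PosDef := by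
  rw [← Matrix.isStrictlyPositive_iff_posDef, IsStrictlyPositive.iff_of_unital]
  exact ⟨IsSelfAdjoint.exp_nonneg hA, Matrix.isUnit_exp A⟩

lemma Matrix.isHermitian_of_smul_one_le {m : ℝ}
    (h : m • (1 : Matrix (Fin n) (Fin n) ℂ) ≤ A) : A.IsHermitian := by
  have h1 : IsSelfAdjoint (m • (1 : Matrix (Fin n) (Fin n) ℂ)) := .smul (.all m) (.one _)
  have h2 := (IsSelfAdjoint.of_nonneg (sub_nonneg.2 h)).add h1
  rwa [sub_add_cancel] at h2

lemma hasDerivAt_arithMean_exp (v : ℝ) (A B : Matrix (Fin n) (Fin n) ℂ) :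
    HasDerivAt (fun p : ℝ => arithMean v (NormedSpace.exp (p • A)) (NormedSpace.exp (p • B)))
      (arithMean v A B) 0 := by
  have h : ∀ X : Matrix (Fin n) (Fin n) ℂ,
      HasDerivAt (fun p : ℝ => NormedSpace.exp (p • X)) X 0 := fun X => by
    simpa using hasDerivAt_exp_smul_const X (0 : ℝ)
  exact ((h A).const_smul (1 - v)).add ((h B).const_smul v)

lemma arithMean_exp_zero_smul (v : ℝ) (A B : Matrix (Fin n) (Fin n) ℂ) :
    arithMean v (NormedSpace.exp ((0 : ℝ) • A)) (NormedSpace.exp ((0 : ℝ) • B)) = 1 := by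
  simp [arithMean, ← add_smul]

lemma harmMean_exp (v p : ℝ) (A B : Matrix (Fin n) (Fin n) ℂ) :
    harmMean v (NormedSpace.exp (p • A)) (NormedSpace.exp (p • B)) =
      Ring.inverse (arithMean v (NormedSpace.exp (p • -A)) (NormedSpace.exp (p • -B))) := by
  rw [harmMean, ← Matrix.exp_neg, ← Matrix.exp_neg, Matrix.nonsing_inv_eq_ringInverse, smul_neg,
    smul_neg]

lemma hasDerivAt_harmMean_exp (v : ℝ) (A B : Matrix (Fin n) (Fin n) ℂ) :
    HasDerivAt (fun p : ℝ => harmMean v (NormedSpace.exp (p • A)) (NormedSpace.exp (p • B)))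
      (arithMean v A B) 0 := by
  simp_rw [harmMean_exp]
  have h := (hasDerivAt_arithMean_exp v (-A) (-B)).ringInverse_of_eq_one
    (arithMean_exp_zero_smul v (-A) (-B))
  have h' : -arithMean v (-A) (-B) = arithMean v A B := by
    simp only [arithMean, smul_neg]
    abel
  rwa [h'] at h

lemma harmMean_exp_zero_smul (v : ℝ) (A B : Matrix (Fin n) (Fin n) ℂ) :
    harmMean v (NormedSpace.exp ((0 : ℝ) • A)) (NormedSpace.exp ((0 : ℝ) • B)) = 1 := by
  rw [harmMean_exp, arithMean_exp_zero_smul, Ring.inverse_one]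

/-- Every operator mean between the harmonic and the arithmetic mean has the same first-order
expansion at the identity along exponential paths. -/
lemma OperatorMean.IsBetween.tendsto_slope_exp {σ : OperatorMean n} {v : ℝ} (hσ : σ.IsBetween v)
    (hA : A.IsHermitian) (hB : B.IsHermitian) :
    Tendsto (fun p : ℝ => p⁻¹ • (σ (NormedSpace.exp (p • A)) (NormedSpace.exp (p • B)) - 1))
      (𝓝[>] 0) (𝓝 (arithMean v A B)) := by
  have hlow := (hasDerivAt_harmMean_exp v A B).tendsto_slope_zero_right
  have hupp := (hasDerivAt_arithMean_exp v A B).tendsto_slope_zero_right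
  simp only [zero_add, harmMean_exp_zero_smul, arithMean_exp_zero_smul] at hlow hupp
  have hmean : ∀ p : ℝ, _ := fun p =>
    hσ _ _ (Matrix.IsHermitian.posDef_exp (A := p • A) (IsSelfAdjoint.smul (.all p) hA))
      (Matrix.IsHermitian.posDef_exp (A := p • B) (IsSelfAdjoint.smul (.all p) hB))
  refine CStarAlgebra.tendsto_of_tendsto_of_tendsto_of_le_of_le hlow hupp ?_ ?_
  · filter_upwards [self_mem_nhdsWithin] with p hp
    exact smul_le_smul_of_nonneg_left (sub_le_sub_right (hmean p).1 1) (inv_pos.2 hp).le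
  · filter_upwards [self_mem_nhdsWithin] with p hp
    exact smul_le_smul_of_nonneg_left (sub_le_sub_right (hmean p).2 1) (inv_pos.2 hp).le

/-- A unitarily invariant norm is continuous: it is a convex function on a finite-dimensional
space. -/
lemma UnitarilyInvariantNorm.continuous (N : UnitarilyInvariantNorm n) : Continuous N := by
  have h : ConvexOn ℝ Set.univ N := N.toSeminorm.convexOn
  exact continuousOn_univ.1 (h.continuousOn isOpen_univ)

end Matrix

/-! ### Convergence of the means -/

theorem mainTheorem5 (n : ℕ) (A B : Matrix (Fin n) (Fin n) ℂ) (m M : ℝ) (hm : 0 < m) (hmM : m < M)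
    (hmA : m • (1 : Matrix (Fin n) (Fin n) ℂ) ≤ A) (hAM : A ≤ M • (1 : Matrix (Fin n) (Fin n) ℂ))
    (hmB : m • (1 : Matrix (Fin n) (Fin n) ℂ) ≤ B) (hBM : B ≤ M • (1 : Matrix (Fin n) (Fin n) ℂ))
    (v : ℝ) (hv0 : 0 ≤ v) (hv1 : v ≤ 1) (σ : OperatorMean n) (hσ : σ.IsBetween v)
    (N : UnitarilyInvariantNorm n) :
    Tendsto
      (fun p : ℝ => N ((σ (NormedSpace.exp (p • A)) (NormedSpace.exp (p • B))) ^ (1 / p)))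
      (𝓝[>] 0) (𝓝 (N (NormedSpace.exp (arithMean v A B)))) := by
  open scoped Matrix.Norms.L2Operator in
  have hA := Matrix.isHermitian_of_smul_one_le hmA
  have hB := Matrix.isHermitian_of_smul_one_le hmB
  have hS : ∀ p : ℝ, 0 ≤ σ (NormedSpace.exp (p • A)) (NormedSpace.exp (p • B)) := fun p =>
    σ.nonneg' _ _
      (IsSelfAdjoint.exp_nonneg (IsSelfAdjoint.smul (.all p) hA))
      (IsSelfAdjoint.exp_nonneg (IsSelfAdjoint.smul (.all p) hB))
  exact (N.continuous.tendsto _).comp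
    (CFC.tendsto_rpow_one_div hS (hσ.tendsto_slope_exp hA hB))
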